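/- **Setting.** Let $(\Omega,\mu)$ be a probability space, $F\subset L_2(\mu)$ a set of real functions and $T:\Omega\to\mathbb R$ a measurable target such that the $L_\infty(\mu)$-diameter $D=\sup\{\|g-h\|_{L_\infty(\mu)} : g,h\in F\cup\{T\}\}$ is finite. Let $f^*\in F$ be a fixed minimizer of the risk $f\mapsto\mathbb E\,(f(X)-T(X))^2$ over $F$, where $X\sim\mu$. For $f\in F$ and $0\le\lambda\le1$ put $T_\lambda=(1-\lambda)T+\lambda f^*$, $$\mathcal L_\lambda(f)=(f-T_\lambda)^2-(f^*-T_\lambda)^2,\qquad \mathcal L(f)=\mathcal L_0(f),$$ and let $Q=\{\mathcal L(f): f\in F,\ \mathbb E\,\mathcal L(f)(X)=0\}$ be the set of excess losses of the risk minimizers. For a finite set $Q'\subset Q$ let $(G_q)_{q\in Q'}$ be the canonical Gaussian process, i.e. the centered Gaussian vector with covariance $\mathbb E\,G_sG_t=\int st\,d\mu$, and let $H(Q')=\mathbb E\max_{q\in Q'}G_q$. **Theorem.** There are constants $c_1,c_2,c_3>0$, depending only on $D$, for which the following holds. If $Q'$ is a finite subset of $Q$ that contains $0$, then there is an integer $n_0$,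 depending only on $\mu$ and $Q'$, such that for every integer $n\ge n_0$ the number $\lambda_n=c_3H(Q')/\sqrt n$ lies in $[0,1]$ and, if $X_1,\dots,X_n$ are independent and distributed according to $\mu$, then with $\mu^n$-probability at least $c_1$, $$\inf_{f\in F:\ \mathcal L(f)\in Q'}\ \frac1n\sum_{i=1}^n\mathcal L_{\lambda_n}(f)(X_i)\ \le\ -c_2\,\frac{H(Q')}{\sqrt n}.$$ -/

import Mathlib

open MeasureTheory ProbabilityTheory
open scoped ENNReal

noncomputable section

namespace ERM

variable {Ω : Type*}

/-- The loss function `ℓ(f, T)` on `Ω` for the squared loss `ℓ(x, y) = (x - y)²`. -/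
def loss (f T : Ω → ℝ) : Ω → ℝ := fun ω => (f ω - T ω) ^ 2

/-- The excess loss `ℓ(f, T) - ℓ(f*, T)` of `f` relative to the target `T`. -/
def excessLoss (fstar T f : Ω → ℝ) : Ω → ℝ := fun ω => loss f T ω - loss fstar T ω

/-- The perturbed target `T_l = (1 - l) T + l f*`. -/
def perturb (fstar T : Ω → ℝ) (l : ℝ) : Ω → ℝ := fun ω => (1 - l) * T ω + l * fstar ω

/-- The empirical mean `P_n g = n⁻¹ ∑ g(X_i)` over the sample `X = (X_1, …, X_n)`. -/
def empMean {n : ℕ} (X : Fin n → Ω) (g : Ω → ℝ) : ℝ := (n : ℝ)⁻¹ * ∑ i, g (X i)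

variable [MeasurableSpace Ω]

/-- The risk `E ℓ(f, T)` of `f` relative to the target `T`. -/
def risk (μ : Measure Ω) (T f : Ω → ℝ) : ℝ := ∫ ω, loss f T ω ∂μ

/-- The set `Q` of the excess losses with mean zero of functions of `F`, i.e. the excess losses
of the minimizers of the risk in `F`. -/
def minimizerLosses (μ : Measure Ω) (F : Set (Ω → ℝ)) (T fstar : Ω → ℝ) : Set (Ω → ℝ) :=
  {q | ∃ f ∈ F, ∫ ω, excessLoss fstar T f ω ∂μ = 0 ∧ q = excessLoss fstar T f}

/-- The diameter of a set of functions in `L_∞(μ)` (the norm is the essential supremum). -/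
def linftyDiam (μ : Measure Ω) (A : Set (Ω → ℝ)) : ℝ≥0∞ :=
  ⨆ f ∈ A, ⨆ g ∈ A, eLpNorm (f - g) ∞ μ

/-- The covariance `⟨s, t⟩ = ∫ s t dμ` of the canonical Gaussian process, on a finite index set. -/
def gaussCov (μ : Measure Ω) (Q : Finset (Ω → ℝ)) : Matrix Q Q ℝ :=
  Matrix.of fun s t => ∫ ω, s.1 ω * t.1 ω ∂μ

/-- For square-integrable functions the covariance is positive semidefinite. -/
theorem posSemidef_gaussCov (μ : Measure Ω) (Q : Finset (Ω → ℝ)) (hQ : ∀ q ∈ Q, MemLp q 2 μ) :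
    (gaussCov μ Q).PosSemidef := by
  have h : gaussCov μ Q = Matrix.gram ℝ (fun q : Q => (hQ q.1 q.2).toLp q.1) := by
    ext s t
    simp only [gaussCov, Matrix.of_apply, Matrix.gram_apply, L2.inner_def]
    refine integral_congr_ae ?_
    filter_upwards [(hQ s.1 s.2).coeFn_toLp, (hQ t.1 t.2).coeFn_toLp] with ω h1 h2
    simp [h1, h2, mul_comm]
  rw [h]
  exact Matrix.posSemidef_gram _ _

open Classical in
/-- The law of the canonical Gaussian process `(G_q)` indexed by the finite set `Q`: the centered
Gaussian measure with `E G_s G_t = ⟨s, t⟩`, where `G_q` is the coordinate `x ↦ x q`. -/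
def gaussLaw (μ : Measure Ω) (Q : Finset (Ω → ℝ)) : Measure (EuclideanSpace ℝ Q) :=
  multivariateGaussian 0 (gaussCov μ Q)

/-- `H(Q) = E sup_{q ∈ Q} G_q` for a finite set `Q` of square-integrable functions. -/
def gaussSup (μ : Measure Ω) (Q : Finset (Ω → ℝ)) : ℝ :=
  ∫ x, (⨆ q : Q, x q) ∂(gaussLaw μ Q)

end ERM

end

noncomputable section

namespace ERM

open Filter Topology Fernique
open scoped Real RealInnerProductSpace

/-! Perturbing the target is harmless: `L_λ(f) = (1 - λ) L(f) + λ (f - f*)²`, so the empirical mean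
of `L_λ(f)` is at most `(1 - λ) P_n L(f) + λ D²`. It suffices that some `q ∈ Q'` has `P_n q ≤ -H /
(2√n)` with probability bounded below, and then to take `λ` a small multiple of `H / √n`.

The vectors `(√n P_n q)` converge in law to the canonical Gaussian vector, and "some coordinate is
below `-H/2`" is an open condition. By the portmanteau theorem its limiting probability is at least
the Gaussian one (`exists_empMean_le_neg`).

The Gaussian probability is bounded below by a second-moment argument
(`le_measureReal_exists_lt_neg`). The coordinate at `0` vanishes, so the maximum norm has mean at
most `2H`. Fernique's theorem bounds its second moment by a multiple of `H²`, with a constant free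
of the dimension (`integral_sq_norm_le`), so the supremum cannot have mean `H` while rarely
exceeding `H/2`. -/

/-! ### Moments of the norm of a Gaussian vector -/

/-- The bound of Fernique's theorem on the exponential moment, for mass `3 / 4`. -/
def ferniqueBound : ℝ≥0∞ :=
  .ofReal (rexp (logRatio (.ofReal (3 / 4)))) +
    ∑' n : ℕ, .ofReal (rexp (-2⁻¹ * Real.log
      (ENNReal.ofReal (3 / 4) / (1 - ENNReal.ofReal (3 / 4))).toReal * 2 ^ n))

lemma one_sub_ofReal_three_quarters :
    1 - ENNReal.ofReal (3 / 4) = ENNReal.ofReal (1 / 4) := by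
  rw [← ENNReal.ofReal_one, ← ENNReal.ofReal_sub _ (by norm_num)]
  norm_num

lemma inv_two_lt_ofReal_three_quarters : (2 : ℝ≥0∞)⁻¹ < ENNReal.ofReal (3 / 4) := by
  have : (2 : ℝ≥0∞)⁻¹ = ENNReal.ofReal (1 / 2) := by
    rw [one_div, ENNReal.ofReal_inv_of_pos (by norm_num)]
    norm_num
  rw [this]
  exact (ENNReal.ofReal_lt_ofReal_iff (by norm_num)).2 (by norm_num)

lemma logRatio_three_quarters_pos : 0 < logRatio (.ofReal (3 / 4)) :=
  logRatio_pos inv_two_lt_ofReal_three_quarters (by rw [ENNReal.ofReal_lt_one]; norm_num)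

lemma ferniqueBound_lt_top : ferniqueBound < ∞ := by
  refine ENNReal.add_lt_top.mpr ⟨ENNReal.ofReal_lt_top, ?_⟩
  refine Summable.tsum_ofReal_lt_top <|
    Real.summable_exp_nat_mul_of_ge ?_ (fun i ↦ mod_cast (Nat.lt_pow_self (by simp)).le)
  refine mul_neg_of_neg_of_pos (by simp) (Real.log_pos ?_)
  rw [one_sub_ofReal_three_quarters, ENNReal.toReal_div, ENNReal.toReal_ofReal (by norm_num),
    ENNReal.toReal_ofReal (by norm_num)]
  norm_num

/-- The constant in the comparison of the first two moments of the norm of a centered Gaussian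
vector. -/
def momentConst : ℝ := max 1 (16 * ferniqueBound.toReal / logRatio (.ofReal (3 / 4)))

lemma one_le_momentConst : 1 ≤ momentConst := le_max_left _ _

/-- Markov's inequality gives the ball of radius `4m` mass at least `3/4`. Fernique's theorem then
bounds the exponential moment of `c ‖x‖² / (4m)²` by a number that depends on this mass only, and `u
≤ exp u` turns it into a second moment bound. -/
theorem integral_sq_norm_le {E : Type*} [NormedAddCommGroup E] [NormedSpace ℝ E]
    [MeasurableSpace E] [BorelSpace E] [SecondCountableTopology E] [CompleteSpace E]
    (γ : Measure E) [IsGaussian γ] (hγ : ∫ x, x ∂γ = 0) {m : ℝ} (hm : 0 < m)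
    (hle : ∫ x, ‖x‖ ∂γ ≤ m) : ∫ x, ‖x‖ ^ 2 ∂γ ≤ momentConst * m ^ 2 := by
  set c : ℝ := logRatio (.ofReal (3 / 4)) with hc
  have hc0 : 0 < c := logRatio_three_quarters_pos
  have hrot : (γ.prod γ).map (ContinuousLinearMap.rotation (-(π / 4))) = γ.prod γ := by
    refine IsGaussian.map_rotation_eq_self_of_forall_strongDual_eq_zero (fun L ↦ ?_) _
    rw [L.integral_comp_id_comm IsGaussian.integrable_id]
    simp [hγ]
  have hint : Integrable (fun x : E ↦ ‖x‖) γ := IsGaussian.integrable_id.norm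
  have hmark : γ.real {x | 4 * m ≤ ‖x‖} ≤ 1 / 4 := by
    have := mul_meas_ge_le_integral_of_nonneg (μ := γ) (f := fun x ↦ ‖x‖)
      (Eventually.of_forall fun x ↦ norm_nonneg x) hint (4 * m)
    by_contra! h
    nlinarith
  have hmass : ENNReal.ofReal (3 / 4) ≤ γ {x | ‖x‖ ≤ 4 * m} := by
    rw [← ofReal_measureReal]
    apply ENNReal.ofReal_le_ofReal
    have h1 : γ.real {x | 4 * m ≤ ‖x‖}ᶜ ≤ γ.real {x | ‖x‖ ≤ 4 * m} :=
      measureReal_mono (fun x hx ↦ by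
        simp only [Set.mem_compl_iff, Set.mem_ofPred_eq, not_le] at hx ⊢; exact hx.le)
    rw [probReal_compl_eq_one_sub (measurableSet_le measurable_const measurable_norm)] at h1
    linarith
  have key := lintegral_exp_mul_sq_norm_le_of_map_rotation_eq_self hrot hmass
    inv_two_lt_ofReal_three_quarters
  have hlin : ∫⁻ x, ENNReal.ofReal (c * (4 * m)⁻¹ ^ 2 * ‖x‖ ^ 2) ∂γ ≤ ferniqueBound := by
    refine (lintegral_mono fun x ↦ ENNReal.ofReal_le_ofReal ?_).trans key
    have := Real.add_one_le_exp (c * (4 * m)⁻¹ ^ 2 * ‖x‖ ^ 2)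
    linarith
  have hreal : ∫ x, c * (4 * m)⁻¹ ^ 2 * ‖x‖ ^ 2 ∂γ ≤ ferniqueBound.toReal := by
    rw [integral_eq_lintegral_of_nonneg_ae (Eventually.of_forall fun x ↦ by positivity)
      (by fun_prop)]
    exact ENNReal.toReal_mono ferniqueBound_lt_top.ne hlin
  rw [integral_const_mul] at hreal
  have h2 : ∫ x, ‖x‖ ^ 2 ∂γ ≤ (16 * ferniqueBound.toReal / c) * m ^ 2 := by
    have : c * (4 * m)⁻¹ ^ 2 * (∫ x, ‖x‖ ^ 2 ∂γ) = (∫ x, ‖x‖ ^ 2 ∂γ) * c / (16 * m ^ 2) := by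
      field_simp; ring
    rw [this, div_le_iff₀ (by positivity), ← le_div_iff₀ hc0] at hreal
    refine hreal.trans_eq ?_
    ring
  exact h2.trans (mul_le_mul_of_nonneg_right (le_max_right _ _) (by positivity))

/-! ### Lower tail of a Gaussian vector -/

/-- A centered Gaussian measure is symmetric. -/
theorem map_neg_eq_self {E : Type*} [NormedAddCommGroup E] [NormedSpace ℝ E]
    [MeasurableSpace E] [BorelSpace E] [SecondCountableTopology E] [CompleteSpace E]
    (γ : Measure E) [IsGaussian γ] (hγ : ∫ x, x ∂γ = 0) : γ.map (fun x ↦ -x) = γ := by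
  have hL : ∀ L : StrongDual ℝ E, γ[L] = 0 := fun L ↦ by
    rw [L.integral_comp_id_comm IsGaussian.integrable_id]
    simp [hγ]
  change γ.map (-(ContinuousLinearMap.id ℝ E)) = γ
  refine Measure.ext_of_charFunDual ?_
  ext L
  rw [charFunDual_map, IsGaussian.charFunDual_eq_of_forall_strongDual_eq_zero hL,
    IsGaussian.charFunDual_eq_of_forall_strongDual_eq_zero hL]
  have : L.comp (-(ContinuousLinearMap.id ℝ E)) = -L := by ext; simp
  rw [this]
  congr 3
  have h := variance_neg (X := L) (μ := γ)
  exact_mod_cast h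

/-- The supremum of a centered Gaussian vector with a vanishing coordinate exceeds half of its mean
with probability bounded from below. -/
theorem le_measureReal_exists_lt_neg {ι : Type*} [Fintype ι] (γ : Measure (ι → ℝ)) [IsGaussian γ]
    (hγ : ∫ x, x ∂γ = 0) (i₀ : ι) (h₀ : ∀ᵐ x ∂γ, x i₀ = 0) {H : ℝ}
    (hH : H = ∫ x, (⨆ i, x i) ∂γ) (hpos : 0 < H) :
    1 / (16 * momentConst) ≤ γ.real {x | ∃ i, x i < -(H / 2)} := by
  have : Nonempty ι := ⟨i₀⟩
  have hsymm := map_neg_eq_self γ hγ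
  have hle (x : ι → ℝ) (i : ι) : x i ≤ ⨆ i, x i := le_ciSup (Set.finite_range x).bddAbove i
  have habs (x : ι → ℝ) : |⨆ i, x i| ≤ ‖x‖ := by
    refine abs_le.2 ⟨?_, ciSup_le fun i ↦ (le_abs_self _).trans (norm_le_pi_norm x i)⟩
    have := neg_abs_le (x i₀)
    have := norm_le_pi_norm x i₀
    rw [Real.norm_eq_abs] at this
    linarith [hle x i₀]
  have hmeas : Measurable fun x : ι → ℝ ↦ ⨆ i, x i :=
    Measurable.iSup fun i ↦ measurable_pi_apply i
  have hnorm : Integrable (fun x : ι → ℝ ↦ ‖x‖) γ := IsGaussian.integrable_id.norm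
  have hnorm2 : Integrable (fun x : ι → ℝ ↦ ‖x‖ ^ 2) γ :=
    IsGaussian.memLp_two_id.norm.integrable_sq
  have hsup : Integrable (fun x : ι → ℝ ↦ ⨆ i, x i) γ :=
    hnorm.mono hmeas.aestronglyMeasurable (Eventually.of_forall fun x ↦ by simpa using habs x)
  have hsup' : Integrable (fun x : ι → ℝ ↦ ⨆ i, (-x) i) γ := by
    rw [← hsymm] at hsup
    exact hsup.comp_measurable measurable_neg
  have hH' : ∫ x, (⨆ i, (-x) i) ∂γ = H := by
    rw [hH]
    conv_rhs => rw [← hsymm]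
    rw [integral_map measurable_neg.aemeasurable hmeas.aestronglyMeasurable]
  -- The vanishing coordinate makes both suprema nonnegative, so their sum dominates every `|x i|`.
  have hnormle : ∫ x, ‖x‖ ∂γ ≤ 2 * H := by
    calc ∫ x, ‖x‖ ∂γ ≤ ∫ x, ((⨆ i, x i) + ⨆ i, (-x) i) ∂γ := by
          refine integral_mono_ae hnorm (hsup.add hsup') ?_
          filter_upwards [h₀] with x hx
          have h1 := hle x i₀
          have h2 := hle (-x) i₀
          rw [hx] at h1
          rw [Pi.neg_apply, hx, neg_zero] at h2
          refine (pi_norm_le_iff_of_nonneg (add_nonneg h1 h2)).2 fun i ↦ ?_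
          have h3 := hle x i
          have h4 := hle (-x) i
          rw [Pi.neg_apply] at h4
          exact abs_le.2 ⟨by linarith, by linarith⟩
      _ = 2 * H := by rw [integral_add hsup hsup', hH', ← hH]; ring
  have hsq := integral_sq_norm_le γ hγ (by positivity : 0 < 2 * H) hnormle
  set C := momentConst
  have hC : 1 ≤ C := one_le_momentConst
  set B : Set (ι → ℝ) := {x | H / 2 < ⨆ i, x i}
  have hB : MeasurableSet B := measurableSet_lt measurable_const hmeas
  have hBint : Integrable (B.indicator fun _ ↦ (1 : ℝ)) γ :=
    (integrable_const 1).indicator hB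
  have hquad : Integrable (fun x : ι → ℝ ↦ H / 2 + (1 / (16 * C * H)) * ‖x‖ ^ 2) γ :=
    (integrable_const _).add (hnorm2.const_mul _)
  -- Off `B` the supremum is at most `H/2`; on `B` it is at most `‖x‖`, split by the AM-GM
  -- inequality. The weight `1 / (16CH)` makes the second moment contribute only `H/4`, which leaves
  -- `H/4` for `B`.
  have hmain : H ≤ H / 2 + (1 / (16 * C * H)) * (4 * C * H ^ 2) + 4 * C * H * γ.real B := by
    calc H = ∫ x, (⨆ i, x i) ∂γ := hH
      _ ≤ ∫ x, (H / 2 + (1 / (16 * C * H)) * ‖x‖ ^ 2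
            + 4 * C * H * B.indicator (fun _ ↦ (1 : ℝ)) x) ∂γ := by
          refine integral_mono hsup (hquad.add (hBint.const_mul _)) fun x ↦ ?_
          by_cases hx : x ∈ B
          · simp only [Set.indicator_of_mem hx]
            have h1 := (le_abs_self _).trans (habs x)
            have h2 : ‖x‖ ≤ 1 / (16 * C * H) * ‖x‖ ^ 2 + 4 * C * H := by
              have : 1 / (16 * C * H) * ‖x‖ ^ 2 + 4 * C * H - ‖x‖
                = (‖x‖ - 8 * C * H) ^ 2 / (16 * C * H) := by field_simp; ring
              have : 0 ≤ (‖x‖ - 8 * C * H) ^ 2 / (16 * C * H) := by positivity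
              linarith
            linarith
          · simp only [Set.indicator_of_notMem hx]
            have h1 : ⨆ i, x i ≤ H / 2 := not_lt.1 hx
            have : 0 ≤ 1 / (16 * C * H) * ‖x‖ ^ 2 := by positivity
            linarith
      _ = H / 2 + (1 / (16 * C * H)) * ∫ x, ‖x‖ ^ 2 ∂γ + 4 * C * H * γ.real B := by
          rw [integral_add hquad (hBint.const_mul _),
            integral_add (integrable_const _) (hnorm2.const_mul _), integral_const_mul,
            integral_const_mul, integral_indicator_const _ hB]
          simp
      _ ≤ _ := by
          gcongr
          linarith
  have hBge : 1 / (16 * C) ≤ γ.real B := by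
    have : 1 / (16 * C * H) * (4 * C * H ^ 2) = H / 4 := by field_simp; norm_num
    rw [this] at hmain
    rw [div_le_iff₀ (by positivity)]
    have : H * 1 ≤ H * (γ.real B * (16 * C)) := by linarith
    exact le_of_mul_le_mul_left this hpos
  refine hBge.trans ?_
  have hpre : (fun x : ι → ℝ ↦ -x) ⁻¹' {x | ∃ i, x i < -(H / 2)} = B := by
    ext x
    simp only [Set.mem_preimage, Set.mem_ofPred_eq, Pi.neg_apply, neg_lt_neg_iff, B]
    exact ⟨fun ⟨i, hi⟩ ↦ hi.trans_le (hle x i), exists_lt_of_lt_ciSup⟩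
  have hM : MeasurableSet {x : ι → ℝ | ∃ i, x i < -(H / 2)} := by
    have : {x : ι → ℝ | ∃ i, x i < -(H / 2)} = ⋃ i, {x | x i < -(H / 2)} := by ext; simp
    rw [this]
    exact MeasurableSet.iUnion fun i ↦ measurableSet_lt (measurable_pi_apply i) measurable_const
  rw [← hpre, ← map_measureReal_apply measurable_neg hM, hsymm]

/-! ### Central limit theorem -/

/-- The characteristic functions in the one-dimensional central limit theorem, for an arbitrary
variance. -/
theorem tendsto_charFun_pow_of_centered (ν : Measure ℝ) [IsProbabilityMeasure ν]
    (h2 : MemLp id 2 ν) (h0 : ∫ x, x ∂ν = 0) :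
    Tendsto (fun n : ℕ ↦ (charFun ν (√n)⁻¹) ^ n) atTop
      (𝓝 (Complex.exp (-((∫ x, x ^ 2 ∂ν : ℝ) : ℂ) / 2))) := by
  set v := ∫ x, x ^ 2 ∂ν with hv
  have hv0 : 0 ≤ v := integral_nonneg fun x ↦ sq_nonneg x
  rcases hv0.eq_or_lt with hv1 | hv1
  · have hae : (fun x : ℝ ↦ x) =ᵐ[ν] fun _ ↦ 0 := by
      have := (integral_eq_zero_iff_of_nonneg (fun x : ℝ ↦ sq_nonneg x) h2.integrable_sq).1
        hv1.symm
      filter_upwards [this] with x hx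
      simpa using hx
    have h1 (t : ℝ) : charFun ν t = 1 := by
      rw [charFun_apply_real]
      have : ∫ x : ℝ, Complex.exp (t * x * Complex.I) ∂ν = ∫ _ : ℝ, (1 : ℂ) ∂ν := by
        refine integral_congr_ae ?_
        filter_upwards [hae] with x hx
        simp [hx]
      simpa using this
    simp [h1, ← hv1]
  -- Normalise to unit variance and evaluate the limit at `√v`.
  · have hs : 0 < √v := Real.sqrt_pos.2 hv1
    have h := tendsto_charFun_inv_sqrt_mul_pow (P := ν) (X := fun x ↦ x / √v) (by fun_prop)
      (by rw [integral_div, h0, zero_div])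
      (by
        have : ((fun x : ℝ ↦ x / √v) ^ 2) = fun x ↦ x ^ 2 / v := by
          ext x; simp [div_pow, Real.sq_sqrt hv0]
        rw [this, integral_div, ← hv, div_self hv1.ne']) (√v)
    convert h using 2 with n
    · congr 1
      have : (fun x : ℝ ↦ x / √v) = fun x ↦ (√v)⁻¹ * x := by ext x; ring
      rw [this, charFun_map_mul]
      congr 1
      field_simp
    · congr 2
      norm_cast
      rw [Real.sq_sqrt hv0]

/-- The central limit theorem in a Euclidean space. -/
theorem tendsto_map_inv_sqrt_smul_sum {E : Type*} [NormedAddCommGroup E] [InnerProductSpace ℝ E]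
    [FiniteDimensional ℝ E] [MeasurableSpace E] [BorelSpace E]
    (ν : ProbabilityMeasure E) (h2 : MemLp id 2 (ν : Measure E)) (h0 : ∫ x, x ∂(ν : Measure E) = 0)
    (γ : ProbabilityMeasure E)
    (hγ : ∀ t, charFun (γ : Measure E) t =
      Complex.exp (-((∫ x, ⟪x, t⟫ ^ 2 ∂(ν : Measure E) : ℝ) : ℂ) / 2))
    (σ : ℕ → ProbabilityMeasure E)
    (hσ : ∀ n, (σ n : Measure E) =
      (Measure.pi fun _ : Fin n ↦ (ν : Measure E)).map (fun x ↦ (√n)⁻¹ • ∑ i, x i)) :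
    Tendsto σ atTop (𝓝 γ) := by
  refine ProbabilityMeasure.tendsto_iff_tendsto_charFun.2 fun t ↦ ?_
  have hmeas : Measurable fun x : E ↦ ⟪x, t⟫ := by fun_prop
  have : IsProbabilityMeasure ((ν : Measure E).map fun x ↦ ⟪x, t⟫) :=
    Measure.isProbabilityMeasure_map hmeas.aemeasurable
  have hL : MemLp (fun x : E ↦ ⟪x, t⟫) 2 (ν : Measure E) := by
    simpa [real_inner_comm] using h2.const_inner t
  have h := tendsto_charFun_pow_of_centered ((ν : Measure E).map fun x ↦ ⟪x, t⟫)
    ((memLp_map_measure_iff (by fun_prop) hmeas.aemeasurable).2 hL)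
    (by
      rw [integral_map hmeas.aemeasurable (by fun_prop)]
      have := integral_inner (𝕜 := ℝ) (h2.integrable (by norm_num)) t
      simp only [id] at this
      simp_rw [real_inner_comm, this, h0, inner_zero_right])
  rw [integral_map hmeas.aemeasurable (by fun_prop)] at h
  rw [hγ]
  convert h using 2 with n
  have h3 : (fun x : Fin n → E ↦ (√n)⁻¹ • ∑ i, x i)
      = (fun y ↦ (√n)⁻¹ • y) ∘ fun x ↦ ∑ i, x i := rfl
  rw [hσ, h3, ← Measure.map_map (by fun_prop) (by fun_prop), charFun_map_smul,
    charFun_map_sum_pi_eq_prod]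
  simp only [Finset.prod_apply, Finset.prod_const, Finset.card_univ, Fintype.card_fin]
  congr 1
  rw [charFun_apply, charFun_apply_real, integral_map hmeas.aemeasurable (by fun_prop)]
  simp only [real_inner_smul_right]
  push_cast
  rfl

/-- Almost sure properties of `μ` may be assumed at all points of the sample. -/
theorem exists_measurable_subset_forall_pi {Ω : Type*} [MeasurableSpace Ω] {μ : Measure Ω}
    [IsProbabilityMeasure μ] {n : ℕ} {A : Set (Fin n → Ω)} (hA : MeasurableSet A) {p : Ω → Prop}
    (hp : ∀ᵐ ω ∂μ, p ω) :
    ∃ B ⊆ A, MeasurableSet B ∧ Measure.pi (fun _ : Fin n ↦ μ) B = Measure.pi (fun _ : Fin n ↦ μ) A ∧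
      ∀ X ∈ B, ∀ i, p (X i) := by
  obtain ⟨s, hs, hsm, hsp⟩ := hp.exists_measurable_mem
  refine ⟨A ∩ ⋂ i, (fun X : Fin n → Ω ↦ X i) ⁻¹' s, Set.inter_subset_left,
    hA.inter (MeasurableSet.iInter fun i ↦ measurable_pi_apply i hsm), ?_, fun X hX i ↦
      hsp _ (Set.mem_iInter.1 hX.2 i)⟩
  refine measure_congr (inter_ae_eq_left_of_ae_eq_univ (eventuallyEq_univ.2 ?_))
  have : ∀ᵐ X ∂(Measure.pi fun _ : Fin n ↦ μ), ∀ i, X i ∈ s := by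
    rw [ae_all_iff]
    exact fun i ↦ (Measure.quasiMeasurePreserving_eval (fun _ : Fin n ↦ μ) i).ae hs
  filter_upwards [this] with X hX
  exact Set.mem_iInter.2 hX

/-! ### Canonical Gaussian process and empirical means -/

section GaussLaw

variable {Ω : Type*} [MeasurableSpace Ω] {μ : Measure Ω} {Q : Finset (Ω → ℝ)}

instance : IsGaussian (gaussLaw μ Q) := by
  classical
  unfold gaussLaw
  infer_instance

/-- The law of the canonical Gaussian process on the space `Q → ℝ` with the supremum norm. -/
def gaussLawPi (μ : Measure Ω) (Q : Finset (Ω → ℝ)) : Measure (Q → ℝ) :=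
  (gaussLaw μ Q).map (EuclideanSpace.equiv Q ℝ)

instance : IsGaussian (gaussLawPi μ Q) := by
  unfold gaussLawPi
  infer_instance

theorem integral_id_gaussLawPi : ∫ x, x ∂(gaussLawPi μ Q) = 0 := by
  classical
  rw [gaussLawPi, integral_map (by fun_prop) (by fun_prop)]
  have := (EuclideanSpace.equiv Q ℝ).toContinuousLinearMap.integral_comp_comm
    (IsGaussian.integrable_fun_id (μ := gaussLaw μ Q))
  refine this.trans ?_
  rw [gaussLaw, integral_id_multivariateGaussian, map_zero]

theorem integral_iSup_gaussLawPi :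
    ∫ x, (⨆ q, x q) ∂(gaussLawPi μ Q) = gaussSup μ Q := by
  rw [gaussLawPi, integral_map (by fun_prop)
    (Measurable.iSup fun i ↦ measurable_pi_apply i).aestronglyMeasurable]
  rfl

theorem ae_apply_zero_gaussLaw (hQ : ∀ q ∈ Q, MemLp q 2 μ) (h0 : 0 ∈ Q) :
    ∀ᵐ x ∂(gaussLaw μ Q), x ⟨0, h0⟩ = 0 := by
  classical
  have h := measurePreserving_eval_multivariateGaussian (μ := 0) (posSemidef_gaussCov μ Q hQ)
    (i := ⟨0, h0⟩)
  have h1 : gaussCov μ Q ⟨0, h0⟩ ⟨0, h0⟩ = 0 := by simp [gaussCov]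
  simp only [h1, Real.toNNReal_zero, gaussianReal_zero_var, PiLp.zero_apply] at h
  have h2 : ∀ᵐ y ∂(Measure.dirac (0 : ℝ)), y = 0 := by simp
  exact h.quasiMeasurePreserving.ae h2

theorem gaussSup_nonneg (hQ : ∀ q ∈ Q, MemLp q 2 μ) (h0 : 0 ∈ Q) : 0 ≤ gaussSup μ Q := by
  refine integral_nonneg_of_ae ?_
  filter_upwards [ae_apply_zero_gaussLaw hQ h0] with x hx
  exact hx.symm.le.trans (le_ciSup (f := fun q : Q ↦ x q) (Set.finite_range _).bddAbove ⟨0, h0⟩)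

/-- The passage to the supremum norm matters: the Euclidean norm would bring the cardinality of `Q`
into the constant. -/
theorem le_gaussLaw_exists_lt_neg (hQ : ∀ q ∈ Q, MemLp q 2 μ) (h0 : 0 ∈ Q)
    (hpos : 0 < gaussSup μ Q) :
    1 / (16 * momentConst) ≤ (gaussLaw μ Q).real {x | ∃ q, x q < -(gaussSup μ Q / 2)} := by
  have hae : ∀ᵐ x ∂(gaussLawPi μ Q), x ⟨0, h0⟩ = 0 := by
    rw [gaussLawPi, ae_map_iff (by fun_prop)
      (measurableSet_eq_fun (measurable_pi_apply _) measurable_const)]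
    exact ae_apply_zero_gaussLaw hQ h0
  have h := le_measureReal_exists_lt_neg (gaussLawPi μ Q) integral_id_gaussLawPi ⟨0, h0⟩ hae
    integral_iSup_gaussLawPi.symm hpos
  have hM : MeasurableSet {x : Q → ℝ | ∃ q, x q < -(gaussSup μ Q / 2)} := by
    simp only [Set.ofPred_exists]
    exact MeasurableSet.iUnion fun i ↦ measurableSet_lt (measurable_pi_apply i) measurable_const
  rwa [gaussLawPi, map_measureReal_apply (by fun_prop) hM] at h

/-- With probability bounded from below by an absolute constant, the smallest empirical mean is of
order `-H(Q) / √n`. -/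
theorem exists_empMean_le_neg [IsProbabilityMeasure μ] (hQ : ∀ q ∈ Q, MemLp q 2 μ)
    (hmean : ∀ q ∈ Q, ∫ ω, q ω ∂μ = 0) (h0 : 0 ∈ Q) (hpos : 0 < gaussSup μ Q) :
    ∃ n₀ : ℕ, ∀ n, n₀ ≤ n → ∃ A : Set (Fin n → Ω), MeasurableSet A ∧
      ENNReal.ofReal (1 / (32 * momentConst)) ≤ Measure.pi (fun _ : Fin n ↦ μ) A ∧
      ∀ X ∈ A, ∃ q ∈ Q, empMean X q ≤ -(gaussSup μ Q / 2) / √n := by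
  classical
  set H := gaussSup μ Q
  -- The members of `Q` are only a.e. measurable. The limit theorem is applied to measurable
  -- versions, and the event is later shrunk by a null set on which they may differ from `q` at a
  -- sample point.
  have hmk (q : Q) := (hQ q.1 q.2).aestronglyMeasurable
  let v (q : Q) : Ω → ℝ := (hmk q).mk q.1
  have hv (q : Q) : Measurable (v q) := (hmk q).stronglyMeasurable_mk.measurable
  have hvq (q : Q) : q.1 =ᵐ[μ] v q := (hmk q).ae_eq_mk
  have hvL (q : Q) : MemLp (v q) 2 μ := (memLp_congr_ae (hvq q)).1 (hQ q.1 q.2)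
  let V : Ω → EuclideanSpace ℝ Q := fun ω ↦ WithLp.toLp 2 fun q ↦ v q ω
  have hV : Measurable V := by
    have : Measurable fun ω (q : Q) ↦ v q ω := measurable_pi_iff.2 hv
    fun_prop
  have hVL : MemLp V 2 μ := MemLp.of_eval_piLp hvL
  let ν : ProbabilityMeasure (EuclideanSpace ℝ Q) :=
    ⟨μ.map V, Measure.isProbabilityMeasure_map hV.aemeasurable⟩
  let γ : ProbabilityMeasure (EuclideanSpace ℝ Q) := ⟨gaussLaw μ Q, inferInstance⟩
  let σ (n : ℕ) : ProbabilityMeasure (EuclideanSpace ℝ Q) :=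
    ⟨(Measure.pi fun _ : Fin n ↦ μ.map V).map (fun x ↦ (√n)⁻¹ • ∑ i, x i), by
      have : IsProbabilityMeasure (μ.map V) := Measure.isProbabilityMeasure_map hV.aemeasurable
      exact Measure.isProbabilityMeasure_map (by fun_prop)⟩
  have hclt : Tendsto σ atTop (𝓝 γ) := by
    refine tendsto_map_inv_sqrt_smul_sum ν ?_ ?_ γ (fun t ↦ ?_) σ fun n ↦ rfl
    · exact (memLp_map_measure_iff (by fun_prop) hV.aemeasurable).2 hVL
    · change ∫ x, x ∂(μ.map V) = 0
      rw [integral_map hV.aemeasurable (by fun_prop)]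
      ext q
      rw [eval_integral_piLp fun q ↦ (hvL q).integrable (by norm_num)]
      change ∫ ω, v q ω ∂μ = 0
      rw [← integral_congr_ae (hvq q), hmean q.1 q.2]
    · change charFun (gaussLaw μ Q) t = Complex.exp (-((∫ x, ⟪x, t⟫ ^ 2 ∂(μ.map V) : ℝ) : ℂ) / 2)
      rw [gaussLaw, charFun_multivariateGaussian (posSemidef_gaussCov μ Q hQ),
        integral_map hV.aemeasurable (by fun_prop)]
      have hsum : ∫ ω, ⟪V ω, t⟫ ^ 2 ∂μ = t.ofLp ⬝ᵥ (gaussCov μ Q).mulVec t.ofLp := by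
        have h1 (ω : Ω) : ⟪V ω, t⟫ ^ 2 = ∑ s, ∑ u, t s * t u * (v s ω * v u ω) := by
          rw [PiLp.inner_apply, sq, Finset.sum_mul_sum]
          refine Finset.sum_congr rfl fun s _ ↦ Finset.sum_congr rfl fun u _ ↦ ?_
          simp only [V, RCLike.inner_apply, conj_trivial]
          ring
        have hint (s u : Q) : Integrable (fun ω ↦ t s * t u * (v s ω * v u ω)) μ :=
          ((hvL s).integrable_mul (hvL u)).const_mul _
        simp_rw [h1]
        rw [integral_finsetSum _ fun s _ ↦ integrable_finsetSum _ fun u _ ↦ hint s u]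
        simp only [dotProduct, Matrix.mulVec, Finset.mul_sum]
        refine Finset.sum_congr rfl fun s _ ↦ ?_
        rw [integral_finsetSum _ fun u _ ↦ hint s u]
        refine Finset.sum_congr rfl fun u _ ↦ ?_
        rw [integral_const_mul]
        have : ∫ ω, v s ω * v u ω ∂μ = gaussCov μ Q s u := by
          refine integral_congr_ae ?_
          filter_upwards [hvq s, hvq u] with ω h1 h2
          rw [h1, h2]
        rw [this]
        ring
      rw [hsum]
      simp [neg_div]
  let G : Set (EuclideanSpace ℝ Q) := {x | ∃ q, x q < -(H / 2)}
  have hG : IsOpen G := by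
    simp only [G, Set.ofPred_exists]
    exact isOpen_iUnion fun q ↦ isOpen_lt (by fun_prop) continuous_const
  have hlim := ProbabilityMeasure.le_liminf_measure_open_of_tendsto hclt hG
  -- Halving the Gaussian bound makes the inequality strict, so it passes from the limit inferior to
  -- all large `n`.
  have hlt : ENNReal.ofReal (1 / (32 * momentConst)) < (γ : Measure (EuclideanSpace ℝ Q)) G := by
    have h1 := le_gaussLaw_exists_lt_neg hQ h0 hpos
    have h2 : 1 / (32 * momentConst) < 1 / (16 * momentConst) := by
      have := one_le_momentConst
      gcongr
      norm_num
    change _ < gaussLaw μ Q G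
    rw [← ofReal_measureReal]
    exact (ENNReal.ofReal_lt_ofReal_iff (lt_of_lt_of_le
      (by have := one_le_momentConst; positivity) h1)).2 (h2.trans_le h1)
  obtain ⟨n₀, hn₀⟩ := eventually_atTop.1 (eventually_lt_of_lt_liminf (hlt.trans_le hlim))
  refine ⟨max n₀ 1, fun n hn ↦ ?_⟩
  have hn1 : 0 < (n : ℝ) := Nat.cast_pos.2 (le_of_max_le_right hn)
  let W : (Fin n → Ω) → EuclideanSpace ℝ Q := fun X ↦ (√n)⁻¹ • ∑ i, V (X i)
  have hW : Measurable W := by fun_prop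
  have hσ : (σ n : Measure (EuclideanSpace ℝ Q)) G = Measure.pi (fun _ : Fin n ↦ μ) (W ⁻¹' G) := by
    have : IsProbabilityMeasure (μ.map V) := Measure.isProbabilityMeasure_map hV.aemeasurable
    change (Measure.pi fun _ : Fin n ↦ μ.map V).map (fun x ↦ (√n)⁻¹ • ∑ i, x i) G = _
    rw [← Measure.pi_map_pi fun _ ↦ hV.aemeasurable, Measure.map_map (by fun_prop) (by fun_prop),
      Measure.map_apply (by fun_prop) hG.measurableSet]
    rfl
  obtain ⟨A, hAW, hA, hAeq, hAv⟩ := exists_measurable_subset_forall_pi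
    (hW hG.measurableSet) (ae_all_iff.2 hvq)
  refine ⟨A, hA, ?_, fun X hX ↦ ?_⟩
  · rw [hAeq, ← hσ]
    exact (hn₀ n (le_of_max_le_left hn)).le
  · obtain ⟨q, hq⟩ := hAW hX
    refine ⟨q.1, q.2, ?_⟩
    have h1 : W X q = (√n)⁻¹ * ∑ i, q.1 (X i) := by
      simp [W, V, hAv X hX]
    rw [h1] at hq
    have hs : 0 < √(n : ℝ) := Real.sqrt_pos.2 hn1
    have h2 : empMean X q.1 = (√n)⁻¹ * ((√n)⁻¹ * ∑ i, q.1 (X i)) := by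
      rw [empMean, ← mul_assoc, ← mul_inv, Real.mul_self_sqrt hn1.le]
    rw [h2, div_eq_inv_mul]
    exact mul_le_mul_of_nonneg_left hq.le (by positivity)

end GaussLaw

/-! ### Perturbed excess losses -/

section ExcessLoss

variable {Ω : Type*}

theorem excessLoss_self (fstar T : Ω → ℝ) : excessLoss fstar T fstar = 0 := by
  ext ω
  simp [excessLoss]

theorem excessLoss_perturb (fstar T f : Ω → ℝ) (l : ℝ) (ω : Ω) :
    excessLoss fstar (perturb fstar T l) f ω =
      (1 - l) * excessLoss fstar T f ω + l * (f ω - fstar ω) ^ 2 := by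
  simp only [excessLoss, perturb, loss]
  ring

theorem empMean_excessLoss_perturb_le {n : ℕ} (hn : 0 < n) {fstar T f : Ω → ℝ} {l D : ℝ}
    (hl : 0 ≤ l) {X : Fin n → Ω} (hX : ∀ i, |f (X i) - fstar (X i)| ≤ D) :
    empMean X (excessLoss fstar (perturb fstar T l) f) ≤
      (1 - l) * empMean X (excessLoss fstar T f) + l * D ^ 2 := by
  have hn' : (0 : ℝ) < n := Nat.cast_pos.2 hn
  have h1 : ∑ i, (f (X i) - fstar (X i)) ^ 2 ≤ n * D ^ 2 := by
    calc ∑ i, (f (X i) - fstar (X i)) ^ 2 ≤ ∑ _i : Fin n, D ^ 2 :=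
          Finset.sum_le_sum fun i _ ↦ sq_le_sq' (abs_le.1 (hX i)).1 (abs_le.1 (hX i)).2
      _ = n * D ^ 2 := by simp
  have h2 : (n : ℝ)⁻¹ * ∑ i, (f (X i) - fstar (X i)) ^ 2 ≤ D ^ 2 := by
    rw [inv_mul_le_iff₀ hn']
    exact h1
  simp only [empMean, excessLoss_perturb, Finset.sum_add_distrib, ← Finset.mul_sum]
  have := mul_le_mul_of_nonneg_left h2 hl
  linarith

variable [MeasurableSpace Ω] {μ : Measure Ω}

theorem ae_abs_sub_le_linftyDiam {S : Set (Ω → ℝ)} (hS : linftyDiam μ S ≠ ∞) {g h : Ω → ℝ}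
    (hg : g ∈ S) (hh : h ∈ S) : ∀ᵐ ω ∂μ, |g ω - h ω| ≤ (linftyDiam μ S).toReal := by
  have hle : eLpNorm (g - h) ∞ μ ≤ linftyDiam μ S :=
    le_iSup₂_of_le g hg (le_iSup₂_of_le (f := fun h _ ↦ eLpNorm (g - h) ∞ μ) h hh le_rfl)
  rw [eLpNorm_exponent_top] at hle
  filter_upwards [ae_le_eLpNormEssSup (f := g - h) (μ := μ)] with ω hω
  have h1 := ENNReal.toReal_mono hS (hω.trans hle)
  simpa using h1

theorem memLp_excessLoss [IsProbabilityMeasure μ] {S : Set (Ω → ℝ)} (hS : linftyDiam μ S ≠ ∞)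
    {fstar T f : Ω → ℝ} (hfstar : fstar ∈ S) (hT : T ∈ S) (hf : f ∈ S)
    (hfstarm : AEStronglyMeasurable fstar μ) (hTm : AEStronglyMeasurable T μ)
    (hfm : AEStronglyMeasurable f μ) : MemLp (excessLoss fstar T f) 2 μ := by
  refine MemLp.of_bound (((hfm.sub hTm).pow 2).sub ((hfstarm.sub hTm).pow 2))
    ((linftyDiam μ S).toReal ^ 2) ?_
  filter_upwards [ae_abs_sub_le_linftyDiam hS hf hT, ae_abs_sub_le_linftyDiam hS hfstar hT]
    with ω h1 h2
  have h3 := sq_le_sq' (abs_le.1 h1).1 (abs_le.1 h1).2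
  have h4 := sq_le_sq' (abs_le.1 h2).1 (abs_le.1 h2).2
  rw [Real.norm_eq_abs, excessLoss, loss, loss]
  exact abs_le.2 ⟨by linarith [sq_nonneg (f ω - T ω)], by linarith [sq_nonneg (fstar ω - T ω)]⟩

end ExcessLoss

end ERM

end

/-! ### Choice of the constants and conclusion -/

theorem theorem3 :
    -- the constants are functions of the diameter alone
    ∃ c₁ c₂ c₃ : ℝ → ℝ, (∀ D, 0 < c₁ D ∧ 0 < c₂ D ∧ 0 < c₃ D) ∧
      ∀ (Ω : Type*) (_ : MeasurableSpace Ω) (μ : Measure Ω) (_ : IsProbabilityMeasure μ)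
        (Q' : Finset (Ω → ℝ)), ∃ n₀ : ℕ,
      ∀ (F : Set (Ω → ℝ)) (T fstar : Ω → ℝ),
        (∀ f ∈ F, MemLp f 2 μ) → AEStronglyMeasurable T μ →
        ERM.linftyDiam μ (insert T F) ≠ ∞ →
        fstar ∈ F → (∀ f ∈ F, ERM.risk μ T fstar ≤ ERM.risk μ T f) →
        (Q' : Set (Ω → ℝ)) ⊆ ERM.minimizerLosses μ F T fstar → 0 ∈ Q' →
      ∀ D : ℝ, D = (ERM.linftyDiam μ (insert T F)).toReal →
      ∀ n : ℕ, n₀ ≤ n →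
      ∀ l : ℝ, l = c₃ D * ERM.gaussSup μ Q' / √n →
        (0 ≤ l ∧ l ≤ 1) ∧
        ∃ A : Set (Fin n → Ω), MeasurableSet A ∧
          ENNReal.ofReal (c₁ D) ≤ Measure.pi (fun _ : Fin n => μ) A ∧
          ∀ X ∈ A,
            (⨅ f ∈ {f | f ∈ F ∧ ERM.excessLoss fstar T f ∈ Q'},
              ((ERM.empMean X (ERM.excessLoss fstar (ERM.perturb fstar T l) f) : ℝ) : EReal))
            ≤ ((-(c₂ D * ERM.gaussSup μ Q' / √n) : ℝ) : EReal) := by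
  have hC := ERM.one_le_momentConst
  -- Write `r = H / √n`. Then `λ D² ≤ r/8`, and the `+ 1` keeps `λ` below `1/2` even for small `D`.
  -- Hence `(1 - λ)(-r/2) + λ D² ≤ -r/4 + r/8 = -r/8`.
  refine ⟨fun _ ↦ 1 / (32 * ERM.momentConst), fun _ ↦ 1 / 8, fun D ↦ 1 / (8 * (D ^ 2 + 1)),
    fun D ↦ ⟨by positivity, by norm_num, by positivity⟩, ?_⟩
  intro Ω _ μ _ Q'
  -- `n₀` must be chosen before `F`, `T` and `f*`, so the split only involves `μ` and `Q'`. In the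
  -- other case the hypotheses on `F` force `H = 0`, hence `λ = 0`, and `f*` itself attains the
  -- bound `0`.
  by_cases hQ : (∀ q ∈ Q', MemLp q 2 μ) ∧ (∀ q ∈ Q', ∫ ω, q ω ∂μ = 0) ∧ 0 ∈ Q' ∧
      0 < ERM.gaussSup μ Q'
  · obtain ⟨hQL, hQm, h0, hpos⟩ := hQ
    obtain ⟨n₁, hn₁⟩ := ERM.exists_empMean_le_neg hQL hQm h0 hpos
    set H := ERM.gaussSup μ Q'
    -- The last term gives `H ≤ √n`, which is what bounds `λ`.
    refine ⟨max n₁ (max 1 ⌈H ^ 2⌉₊), ?_⟩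
    intro F T fstar hF hT hdiam hfstar _ hsub _ D hD n hn l hl
    have hn1 : 0 < n := (le_max_left _ _).trans ((le_max_right _ _).trans hn)
    have hnH : H ≤ √n := Real.le_sqrt_of_sq_le
      (Nat.ceil_le.1 ((le_max_right _ _).trans ((le_max_right _ _).trans hn)))
    have hs : 0 < √(n : ℝ) := Real.sqrt_pos.2 (Nat.cast_pos.2 hn1)
    have hr0 : 0 < H / √n := by positivity
    have hr1 : H / √n ≤ 1 := (div_le_one hs).2 hnH
    have hl' : l * (D ^ 2 + 1) = H / √n / 8 := by
      rw [hl]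
      field_simp
    have hl0 : 0 ≤ l := by rw [hl]; positivity
    have hlD : l * D ^ 2 ≤ H / √n / 8 := by linarith
    have hl1 : l ≤ 1 / 2 := by nlinarith [mul_nonneg hl0 (sq_nonneg D)]
    refine ⟨⟨hl0, by linarith⟩, ?_⟩
    obtain ⟨A, hA, hAmass, hAX⟩ := hn₁ n ((le_max_left _ _).trans hn)
    have hsub' : ∀ q ∈ Q', ∃ f ∈ F, q = ERM.excessLoss fstar T f := fun q hq ↦ by
      obtain ⟨f, hf, -, h⟩ := hsub hq
      exact ⟨f, hf, h⟩
    choose! φ hφF hφ using hsub'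
    have hclose : ∀ᵐ ω ∂μ, ∀ q : Q', |φ q.1 ω - fstar ω| ≤ D := by
      rw [ae_all_iff]
      intro q
      rw [hD]
      exact ERM.ae_abs_sub_le_linftyDiam hdiam (Set.mem_insert_of_mem _ (hφF _ q.2))
        (Set.mem_insert_of_mem _ hfstar)
    obtain ⟨B, hBA, hB, hBeq, hBX⟩ := ERM.exists_measurable_subset_forall_pi hA hclose
    refine ⟨B, hB, hBeq ▸ hAmass, fun X hX ↦ ?_⟩
    obtain ⟨q, hq, hqX⟩ := hAX X (hBA hX)
    refine (iInf₂_le (φ q) ⟨hφF q hq, hφ q hq ▸ hq⟩).trans (EReal.coe_le_coe_iff.2 ?_)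
    refine (ERM.empMean_excessLoss_perturb_le hn1 hl0 fun i ↦ hBX X hX i ⟨q, hq⟩).trans ?_
    rw [← hφ q hq]
    have h1 : -(H / 2) / √n = -(H / √n / 2) := by ring
    have h2 : -(1 / 8 * H / √n) = -(H / √n / 8) := by ring
    rw [h1] at hqX
    rw [h2]
    have h3 : (1 - l) * ERM.empMean X q ≤ (1 - l) * -(H / √n / 2) :=
      mul_le_mul_of_nonneg_left hqX (by linarith)
    nlinarith
  · refine ⟨0, ?_⟩
    intro F T fstar hF hT hdiam hfstar _ hsub h0 D hD n _ l hl
    have hQL : ∀ q ∈ Q', MemLp q 2 μ := fun q hq ↦ by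
      obtain ⟨f, hf, -, rfl⟩ := hsub hq
      exact ERM.memLp_excessLoss hdiam (Set.mem_insert_of_mem _ hfstar) (Set.mem_insert _ _)
        (Set.mem_insert_of_mem _ hf) (hF _ hfstar).aestronglyMeasurable hT
        (hF _ hf).aestronglyMeasurable
    have hQm : ∀ q ∈ Q', ∫ ω, q ω ∂μ = 0 := fun q hq ↦ by
      obtain ⟨f, -, hf, rfl⟩ := hsub hq
      exact hf
    have hH : ERM.gaussSup μ Q' = 0 :=
      le_antisymm (not_lt.1 fun h ↦ hQ ⟨hQL, hQm, h0, h⟩) (ERM.gaussSup_nonneg hQL h0)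
    rw [hH, mul_zero, zero_div] at hl
    subst hl
    refine ⟨⟨le_rfl, zero_le_one⟩, Set.univ, MeasurableSet.univ, ?_, fun X _ ↦ ?_⟩
    · rw [measure_univ, ENNReal.ofReal_le_one, div_le_one (by positivity)]
      linarith
    · refine (iInf₂_le fstar ⟨hfstar, by rwa [ERM.excessLoss_self]⟩).trans
        (EReal.coe_le_coe_iff.2 ?_)
      simp [ERM.excessLoss_self, ERM.empMean, hH]
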